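/- **Generalized Cauchy Integral Theorem.** *Definitions.* Identify $\mathbb C$ with $\mathbb R^2$. For $V=\mathbb R$ (0-chains) or $V=\mathbb R^2$ (1-chains), a pointed chain is a finite formal sum $A=\sum_i (p_i;\alpha_i)$ with $p_i\in\mathbb R^2$, $\alpha_i\in V$, i.e. a finitely supported function $\mathbb R^2\to V$. For $u\in\mathbb R^2$ let $\Delta_u(p;\alpha)=(p+u;\alpha)-(p;\alpha)$, extended linearly. For an integer $r\ge 0$ put $$\|A\|_{B^r}=\inf\Big\{\sum_{i=1}^N \|u_{i,1}\|\cdots\|u_{i,j_i}\|\,\|\alpha_i\| \;:\; A=\sum_{i=1}^N \Delta_{u_{i,1}}\cdots\Delta_{u_{i,j_i}}(p_i;\alpha_i),\ 0\le j_i\le r\Big\}.$$ The space of differential chains of order $r$ is the completion of the space of pointed chains in this norm; it is denoted $\hat{\mathcal B}^r_0$ for $V=\mathbb R$ and $\hat{\mathcal B}^r_1$ for $V=\mathbb R^2$. The space $\mathcal B^r_1$ consists of the real differential 1-forms $\omega$ on $\mathbb R^2$ for which there is a constant $C$ with $|\omega(\Delta_{u_1}\cdots\Delta_{u_j}(p;\alpha))|\le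 C\,\|u_1\|\cdots\|u_j\|\,\|\alpha\|$ for all $0\le j\le r$ and all $u_1,\dots,u_j,p,\alpha$, where $\omega(\sum_i(p_i;\alpha_i))=\sum_i\omega_{p_i}(\alpha_i)$. The Harrison integral of $\omega\in\mathcal B^r_1$ over $J\in\hat{\mathcal B}^r_1$ is $\int_J\omega:=\omega(J)$, where $\omega$ is extended to $\hat{\mathcal B}^r_1$ by continuity. For $r\ge1$ the boundary $\partial:\hat{\mathcal B}^r_1\to\hat{\mathcal B}^{r+1}_0$ is the continuous linear operator $\partial=\sum_i P_{v_i}\circ E^\dagger_{v_i}$, where $(v_i)$ is an orthonormal basis of $\mathbb R^2$, and $E_v^\dagger$, $P_v$ are the extensions by linearity and continuity of $E_v^\dagger(p;w)=(p;\langle v,w\rangle)$ and $P_v(p;a)=\lim_{t\to0}\Delta_{tv}(p;a/t)$ (limit in $\hat{\mathcal B}^{r+1}_0$). The chain $J$ is closed if $\partial J=0$. A closed set $X$ supports $J$ if for every non-empty open $W\supseteq X$ there are pointed chains $A_i$, all of whose points lie in $W$, with $A_i\to J$ in $\hat{\mathcal B}^r_1$. The support $\operatorname{supp}(J)$ is the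 intersection of all closed sets supporting $J$, and $J$ is supported in a set $U$ if $\operatorname{supp}(J)\subseteq U$. If a real 1-form $\eta$, defined near $\operatorname{supp}(J)$, agrees on a neighbourhood of $\operatorname{supp}(J)$ with some $\omega\in\mathcal B^r_1$, and all such $\omega$ give the same value $\int_J\omega$, then $\int_J\eta$ is said to be well defined, with this common value. For $f=u+iv$ with $u,v$ real, $$\int_J f(z)\,dz:=\int_J(u\,dx-v\,dy)+i\int_J(v\,dx+u\,dy).$$ *Theorem.* Let $U\subset\mathbb C$ be a bounded contractible open set, let $f:U\to\mathbb C$ be holomorphic, and let $J\in\hat{\mathcal B}^r_1$, for some integer $r\ge1$, be a (real) closed differential 1-chain of order $r$ supported in $U$. Then $\int_J f(z)\,dz$ is well defined and $$\int_J f(z)\,dz=0.$$ -/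

import Mathlib

open Filter Topology

set_option linter.unusedSectionVars false

noncomputable section

namespace Harrison

section Pointed

variable {E V : Type*} [NormedAddCommGroup E] [NormedAddCommGroup V] [NormedSpace ℝ V]

/-- The translation operator `T_u : ∑ (p; α) ↦ ∑ (p + u; α)` on finitely supported
functions `E → V`; the element `(p; α)` is `Finsupp.single p α`. -/
def translate (u : E) : (E →₀ V) →ₗ[ℝ] (E →₀ V) :=
  Finsupp.lmapDomain V ℝ (fun p => p + u)

/-- The difference operator `Δ_u = T_u - Id`. -/
def difference (u : E) : (E →₀ V) →ₗ[ℝ] (E →₀ V) :=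
  translate u - LinearMap.id

/-- The difference chain `Δ_{u₁} ⋯ Δ_{u_j} (p; α)`, where `U = [u₁, …, u_j]`. -/
def diffChain (U : List E) (p : E) (α : V) : E →₀ V :=
  U.foldr (fun u A => difference u A) (Finsupp.single p α)

/-- The size `‖u₁‖ ⋯ ‖u_j‖ ‖α‖` of the difference chain `Δ_{u₁} ⋯ Δ_{u_j} (p; α)`. -/
def diffSize (U : List E) (α : V) : ℝ :=
  (U.map fun u => ‖u‖).prod * ‖α‖

/-- The values `∑ |Δ_{U_i} (p_i; α_i)|` over all ways of writing `A` as a finite sum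
`∑ Δ_{U_i} (p_i; α_i)` of difference chains of orders at most `r`. -/
def costs (r : ℕ) (A : E →₀ V) : Set ℝ :=
  {s | ∃ L : List (List E × E × V), (∀ d ∈ L, d.1.length ≤ r) ∧
    (L.map fun d => diffChain d.1 d.2.1 d.2.2).sum = A ∧
    (L.map fun d => diffSize d.1 d.2.2).sum = s}

/-- The `r`-norm `‖A‖_{B^r}` of a pointed chain. -/
def rNorm (r : ℕ) (A : E →₀ V) : ℝ :=
  sInf (costs r A)

theorem diffSize_nonneg (U : List E) (α : V) : 0 ≤ diffSize U α := by
  refine mul_nonneg (List.prod_nonneg ?_) (norm_nonneg _)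
  intro a ha
  obtain ⟨u, -, rfl⟩ := List.mem_map.1 ha
  exact norm_nonneg _

theorem costs_nonneg {r : ℕ} {A : E →₀ V} {s : ℝ} (hs : s ∈ costs r A) : 0 ≤ s := by
  obtain ⟨L, -, -, rfl⟩ := hs
  refine List.sum_nonneg ?_
  intro a ha
  obtain ⟨u, -, rfl⟩ := List.mem_map.1 ha
  exact diffSize_nonneg _ _

theorem costs_bddBelow (r : ℕ) (A : E →₀ V) : BddBelow (costs r A) :=
  ⟨0, fun _ hs => costs_nonneg hs⟩

theorem costs_add {r : ℕ} {A B : E →₀ V} {s t : ℝ} (hs : s ∈ costs r A)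
    (ht : t ∈ costs r B) : s + t ∈ costs r (A + B) := by
  obtain ⟨L, hL, rfl, rfl⟩ := hs
  obtain ⟨M, hM, rfl, rfl⟩ := ht
  refine ⟨L ++ M, ?_, by simp, by simp⟩
  intro d hd
  rcases List.mem_append.1 hd with h | h
  exacts [hL d h, hM d h]

theorem costs_diffChain {r : ℕ} {U : List E} (hU : U.length ≤ r) (p : E) (α : V) :
    diffSize U α ∈ costs r (diffChain U p α) :=
  ⟨[(U, p, α)], by simpa using hU, by simp, by simp⟩

theorem costs_nonempty (r : ℕ) (A : E →₀ V) : (costs r A).Nonempty := by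
  induction A using Finsupp.induction_linear with
  | zero => exact ⟨0, [], by simp, by simp, by simp⟩
  | add A B hA hB =>
    obtain ⟨s, hs⟩ := hA
    obtain ⟨t, ht⟩ := hB
    exact ⟨_, costs_add hs ht⟩
  | single p α => exact ⟨_, costs_diffChain (U := []) (by simp) p α⟩

theorem rNorm_nonneg (r : ℕ) (A : E →₀ V) : 0 ≤ rNorm r A :=
  Real.sInf_nonneg fun _ hs => costs_nonneg hs

theorem rNorm_le {r : ℕ} {A : E →₀ V} {s : ℝ} (hs : s ∈ costs r A) : rNorm r A ≤ s :=
  csInf_le (costs_bddBelow r A) hs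

/-- To bound a subadditive quantity by the `r`-norm it is enough to bound it on difference
chains. -/
theorem le_rNorm_of_diffChain {F : Type*} [SeminormedAddCommGroup F] {r : ℕ}
    (T : (E →₀ V) →+ F) (C : ℝ) (hC : 0 ≤ C)
    (hT : ∀ (U : List E) (p : E) (α : V), U.length ≤ r →
      ‖T (diffChain U p α)‖ ≤ C * diffSize U α) (A : E →₀ V) :
    ‖T A‖ ≤ C * rNorm r A := by
  have key : ∀ s ∈ costs r A, ‖T A‖ ≤ C * s := by
    rintro s ⟨L, hL, rfl, rfl⟩
    induction L with
    | nil => simp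
    | cons d L ih =>
      simp only [List.map_cons, List.sum_cons, map_add, mul_add]
      refine (norm_add_le _ _).trans (add_le_add (hT _ _ _ (hL d (by simp))) (ih ?_))
      exact fun e he => hL e (by simp [he])
  rcases hC.eq_or_lt with rfl | hC
  · obtain ⟨s, hs⟩ := costs_nonempty r A
    simpa using key s hs
  · rw [← div_le_iff₀' hC]
    exact le_csInf (costs_nonempty r A) fun s hs => (div_le_iff₀' hC).2 (key s hs)

theorem rNorm_add_le (r : ℕ) (A B : E →₀ V) : rNorm r (A + B) ≤ rNorm r A + rNorm r B := by
  refine le_of_forall_pos_le_add fun ε hε => ?_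
  obtain ⟨s, hs, hs'⟩ := exists_lt_of_csInf_lt (costs_nonempty r A)
    (show sInf (costs r A) < rNorm r A + ε / 2 by unfold rNorm; linarith)
  obtain ⟨t, ht, ht'⟩ := exists_lt_of_csInf_lt (costs_nonempty r B)
    (show sInf (costs r B) < rNorm r B + ε / 2 by unfold rNorm; linarith)
  have := rNorm_le (costs_add hs ht)
  linarith

theorem rNorm_zero (r : ℕ) : rNorm r (0 : E →₀ V) = 0 :=
  le_antisymm (rNorm_le ⟨[], by simp, by simp, by simp⟩) (rNorm_nonneg _ _)

theorem diffChain_smul (U : List E) (p : E) (c : ℝ) (α : V) :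
    diffChain U p (c • α) = c • diffChain U p α := by
  induction U with
  | nil => simp [diffChain]
  | cons u U ih =>
    simp only [diffChain, List.foldr_cons] at ih ⊢
    rw [ih, map_smul]

theorem diffSize_smul (U : List E) (c : ℝ) (α : V) :
    diffSize U (c • α) = ‖c‖ * diffSize U α := by
  simp only [diffSize, norm_smul]; ring

theorem rNorm_smul_le (r : ℕ) (c : ℝ) (A : E →₀ V) : rNorm r (c • A) ≤ ‖c‖ * rNorm r A := by
  have key : ∀ s ∈ costs r A, rNorm r (c • A) ≤ ‖c‖ * s := by
    rintro s ⟨L, hL, rfl, rfl⟩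
    refine rNorm_le ⟨L.map fun d => (d.1, d.2.1, c • d.2.2), ?_, ?_, ?_⟩
    · intro d hd
      obtain ⟨e, he, rfl⟩ := List.mem_map.1 hd
      exact hL e he
    · rw [List.map_map, List.smul_sum, List.map_map]
      congr 2
      funext d
      simp [diffChain_smul]
    · rw [List.map_map, ← List.sum_map_mul_left]
      congr 2
      funext d
      simp [diffSize_smul]
  rcases (norm_nonneg c).eq_or_lt with h | h
  · obtain ⟨s, hs⟩ := costs_nonempty r A
    simpa [← h] using key s hs
  · rw [← div_le_iff₀' h]
    exact le_csInf (costs_nonempty r A) fun s hs => (div_le_iff₀' h).2 (key s hs)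

theorem rNorm_neg (r : ℕ) (A : E →₀ V) : rNorm r (-A) = rNorm r A := by
  have h : ∀ B : E →₀ V, rNorm r (-B) ≤ rNorm r B := fun B => by
    simpa using rNorm_smul_le r (-1) B
  exact le_antisymm (h A) (by simpa using h (-A))

theorem difference_comm (u v : E) (A : E →₀ V) :
    difference u (difference v A) = difference v (difference u A) := by
  have h : translate u (translate v A) = translate v (translate u A) := by
    simp only [translate, Finsupp.lmapDomain_apply, ← Finsupp.mapDomain_comp]
    congr 1
    funext p
    simp [add_right_comm]
  simp only [difference, LinearMap.sub_apply, LinearMap.id_apply, map_sub, h]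
  abel

/-- `Δ_{u+v} = Δ_u + Δ_v + Δ_u Δ_v`. -/
theorem difference_add (u v : E) (A : E →₀ V) :
    difference (u + v) A = difference u A + difference v A + difference u (difference v A) := by
  have h : translate (u + v) A = translate u (translate v A) := by
    simp only [translate, Finsupp.lmapDomain_apply, ← Finsupp.mapDomain_comp]
    congr 1
    funext p
    simp [add_comm u v, add_assoc]
  simp only [difference, LinearMap.sub_apply, LinearMap.id_apply, map_sub, h]
  abel

theorem rNorm_difference_le (r : ℕ) (u : E) (A : E →₀ V) :
    rNorm (r + 1) (difference u A) ≤ ‖u‖ * rNorm r A := by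
  have key : ∀ s ∈ costs r A, rNorm (r + 1) (difference u A) ≤ ‖u‖ * s := by
    rintro s ⟨L, hL, rfl, rfl⟩
    refine rNorm_le ⟨L.map fun d => (u :: d.1, d.2.1, d.2.2), ?_, ?_, ?_⟩
    · intro d hd
      obtain ⟨e, he, rfl⟩ := List.mem_map.1 hd
      simpa using hL e he
    · rw [List.map_map, map_list_sum, List.map_map]
      rfl
    · rw [List.map_map, ← List.sum_map_mul_left]
      congr 2
      funext d
      simp [diffSize, mul_assoc]
  rcases (norm_nonneg u).eq_or_lt with h | h
  · obtain ⟨s, hs⟩ := costs_nonempty r A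
    simpa [← h] using key s hs
  · rw [← div_le_iff₀' h]
    exact le_csInf (costs_nonempty r A) fun s hs => (div_le_iff₀' h).2 (key s hs)

end Pointed

/-- Pointed chains on `E` with coefficients in `V`, carrying the `r`-norm. For `V = ℝ = Λ⁰E`
these are the pointed `0`-chains, and for `V = E = Λ¹E` the pointed `1`-chains; in both cases
the mass norm of a coefficient is its norm. -/
def PointedChain (E V : Type*) [NormedAddCommGroup E] [NormedAddCommGroup V] (_r : ℕ) : Type _ :=
  E →₀ V

section Chains

variable {E V : Type*} [NormedAddCommGroup E] [NormedAddCommGroup V] [NormedSpace ℝ V] {r : ℕ}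

instance : AddCommGroup (PointedChain E V r) := inferInstanceAs (AddCommGroup (E →₀ V))

instance : Module ℝ (PointedChain E V r) := inferInstanceAs (Module ℝ (E →₀ V))

instance : SeminormedAddCommGroup (PointedChain E V r) :=
  AddGroupSeminorm.toSeminormedAddCommGroup
    { toFun := rNorm (E := E) (V := V) r
      map_zero' := rNorm_zero r
      add_le' := rNorm_add_le r
      neg' := rNorm_neg r }

instance : NormedSpace ℝ (PointedChain E V r) where
  norm_smul_le := rNorm_smul_le (E := E) (V := V) r

/-- A pointed chain as a finitely supported function `E → V`. -/
def PointedChain.toFinsupp : PointedChain E V r ≃ₗ[ℝ] (E →₀ V) :=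
  LinearEquiv.refl ℝ (E →₀ V)

theorem PointedChain.norm_eq (A : PointedChain E V r) : ‖A‖ = rNorm r A.toFinsupp := rfl

/-- The finite set of points at which a pointed chain is supported. -/
def PointedChain.points (A : PointedChain E V r) : Set E :=
  A.toFinsupp.support

variable (E V r) in
/-- Differential chains of order `r`: the completion of the pointed chains in the `r`-norm. -/
abbrev Chain : Type _ := UniformSpace.Completion (PointedChain E V r)

/-- The extension by continuity of a continuous linear operator from pointed chains to
differential chains. -/
def Chain.extend {F : Type*} [NormedAddCommGroup F] [NormedSpace ℝ F] [CompleteSpace F]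
    (T : PointedChain E V r →L[ℝ] F) : Chain E V r →L[ℝ] F :=
  T.extend UniformSpace.Completion.toComplL

theorem Chain.extend_coe {F : Type*} [NormedAddCommGroup F] [NormedSpace ℝ F] [CompleteSpace F]
    (T : PointedChain E V r →L[ℝ] F) (A : PointedChain E V r) :
    Chain.extend T (A : Chain E V r) = T A :=
  ContinuousLinearMap.extend_eq (e := UniformSpace.Completion.toComplL) T
    UniformSpace.Completion.denseRange_coe
    (UniformSpace.Completion.isUniformInducing_coe _) A

/-- A closed set `X` supports `J` if `J` is, for every non-empty open `W ⊇ X`, a limit of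
pointed chains in `W`. -/
def Chain.IsSupportedBy (J : Chain E V r) (X : Set E) : Prop :=
  ∀ W : Set E, IsOpen W → W.Nonempty → X ⊆ W →
    ∃ A : ℕ → PointedChain E V r, (∀ i, (A i).points ⊆ W) ∧
      Tendsto (fun i => (A i : Chain E V r)) atTop (𝓝 J)

/-- The support of a differential chain: the intersection of the closed sets supporting it. -/
def Chain.supp (J : Chain E V r) : Set E :=
  ⋂₀ {X | IsClosed X ∧ J.IsSupportedBy X}

variable (E V r) in
/-- The space `B^r` of differential forms: the forms `ω` with `‖ω‖_{B^r} < ∞`, that is, with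
`|ω (Δ_U (p; α))| ≤ C |Δ_U (p; α)|` for one constant `C` and all difference chains of order
at most `r`. -/
structure BForm where
  /-- the value `ω_p` of the form at the point `p` -/
  toFun : E → V →ₗ[ℝ] ℝ
  bounded : ∃ C : ℝ, ∀ (U : List E) (p : E) (α : V), U.length ≤ r →
    |Finsupp.lsum ℝ toFun (diffChain U p α)| ≤ C * diffSize U α

/-- A form `ω ∈ B^r` as a continuous functional `∑ (p; α) ↦ ∑ ω_p α` on pointed chains. -/
def BForm.eval (ω : BForm E V r) : PointedChain E V r →L[ℝ] ℝ :=
  LinearMap.mkContinuousOfExistsBound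
    ((Finsupp.lsum ℝ ω.toFun).comp PointedChain.toFinsupp.toLinearMap) (by
      obtain ⟨C, hC⟩ := ω.bounded
      refine ⟨max C 0, fun A => ?_⟩
      refine le_rNorm_of_diffChain (Finsupp.lsum ℝ ω.toFun).toAddMonoidHom _
        (le_max_right _ _) ?_ A.toFinsupp
      intro U p α hU
      exact (hC U p α hU).trans
        (mul_le_mul_of_nonneg_right (le_max_left _ _) (diffSize_nonneg _ _)))

theorem BForm.eval_apply (ω : BForm E V r) (A : PointedChain E V r) :
    ω.eval A = A.toFinsupp.sum fun p α => ω.toFun p α := rfl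

/-- The Harrison integral `∫_J ω = ω(J)` of `ω ∈ B^r` over a differential chain `J` of
order `r`. -/
def integral (J : Chain E V r) (ω : BForm E V r) : ℝ :=
  Chain.extend ω.eval J

/-- `∫_J η` is defined and equal to `c`, for a form `η` that matters only near `supp J`:
`η` agrees near `supp J` with some form in `B^r`, and every form in `B^r` that agrees
with `η` near `supp J` has Harrison integral `c` over `J`. -/
def HasIntegral (J : Chain E V r) (η : E → V →ₗ[ℝ] ℝ) (c : ℝ) : Prop :=
  (∃ ω : BForm E V r, ∀ᶠ p in 𝓝ˢ J.supp, ω.toFun p = η p) ∧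
    ∀ ω : BForm E V r, (∀ᶠ p in 𝓝ˢ J.supp, ω.toFun p = η p) → integral J ω = c

end Chains

section Boundary

/-- A bounded curve that is additive up to a bilinear error has a derivative at `0`. -/
theorem exists_tendsto_of_almost_additive {F : Type*} [NormedAddCommGroup F] [NormedSpace ℝ F]
    [CompleteSpace F] (f : ℝ → F) (C D : ℝ)
    (hadd : ∀ s t, ‖f (s + t) - f s - f t‖ ≤ C * (|s| * |t|)) (hbd : ∀ t, ‖f t‖ ≤ D * |t|) :
    ∃ l, Tendsto (fun t : ℝ => t⁻¹ • f t) (𝓝[≠] 0) (𝓝 l) := by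
  let a : ℝ → ℕ → F := fun t k => (2 : ℝ) ^ k • f (t / 2 ^ k)
  have hstep : ∀ t k, dist (a t k) (a t (k + 1)) ≤ C * t ^ 2 / 2 / 2 / 2 ^ k := by
    intro t k
    have h2 : t / 2 ^ k = t / 2 ^ (k + 1) + t / 2 ^ (k + 1) := by
      rw [pow_succ]; field_simp; ring
    have h1 := hadd (t / 2 ^ (k + 1)) (t / 2 ^ (k + 1))
    rw [← h2] at h1
    have h3 : a t k - a t (k + 1) =
        (2 : ℝ) ^ k • (f (t / 2 ^ k) - f (t / 2 ^ (k + 1)) - f (t / 2 ^ (k + 1))) := by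
      simp only [a, pow_succ]
      module
    rw [dist_eq_norm, h3, norm_smul, Real.norm_of_nonneg (by positivity)]
    refine (mul_le_mul_of_nonneg_left h1 (by positivity)).trans (le_of_eq ?_)
    rw [← abs_mul, abs_of_nonneg (mul_self_nonneg _), pow_succ]
    field_simp
  have hlim : ∀ t, ∃ l, Tendsto (a t) atTop (𝓝 l) := fun t =>
    cauchySeq_tendsto_of_complete (cauchySeq_of_le_geometric_two (C := C * t ^ 2 / 2)
      (fun k => hstep t k))
  choose g hg using hlim
  have hfg : ∀ t, ‖f t - g t‖ ≤ C * t ^ 2 / 2 := fun t => by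
    simpa [a, dist_eq_norm] using dist_le_of_le_geometric_two_of_tendsto₀ (hstep t) (hg t)
  have hgbd : ∀ t, ‖g t‖ ≤ D * |t| := fun t => by
    refine le_of_tendsto (hg t).norm (Eventually.of_forall fun k => ?_)
    simp only [a]
    rw [norm_smul, Real.norm_of_nonneg (by positivity)]
    refine (mul_le_mul_of_nonneg_left (hbd _) (by positivity)).trans (le_of_eq ?_)
    rw [abs_div, abs_of_pos (show (0 : ℝ) < 2 ^ k by positivity)]
    field_simp
  have hgadd : ∀ s t, g (s + t) = g s + g t := by
    intro s t
    have h1 : Tendsto (fun k => a (s + t) k - a s k - a t k) atTop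
        (𝓝 (g (s + t) - g s - g t)) := ((hg _).sub (hg s)).sub (hg t)
    have h2 : Tendsto (fun k => a (s + t) k - a s k - a t k) atTop (𝓝 0) := by
      have h0 : Tendsto (fun k : ℕ => C * (|s| * |t|) * (1 / 2 : ℝ) ^ k) atTop (𝓝 0) := by
        simpa using (tendsto_pow_atTop_nhds_zero_of_lt_one (r := (1 / 2 : ℝ)) (by norm_num)
          (by norm_num)).const_mul (C * (|s| * |t|))
      refine squeeze_zero_norm (fun k => ?_) h0
      have h3 : a (s + t) k - a s k - a t k =
          (2 : ℝ) ^ k • (f (s / 2 ^ k + t / 2 ^ k) - f (s / 2 ^ k) - f (t / 2 ^ k)) := by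
        simp only [a, smul_sub, add_div]
      rw [h3, norm_smul, Real.norm_of_nonneg (by positivity)]
      refine (mul_le_mul_of_nonneg_left (hadd _ _) (by positivity)).trans (le_of_eq ?_)
      rw [abs_div, abs_div, abs_of_pos (show (0 : ℝ) < 2 ^ k by positivity), one_div, inv_pow]
      field_simp
    have h4 := tendsto_nhds_unique h1 h2
    rw [sub_sub, sub_eq_zero] at h4
    exact h4
  let G : ℝ →+ F := AddMonoidHom.mk' g hgadd
  have hG : Continuous G := by
    refine AddMonoidHomClass.continuous_of_bound G D fun t => ?_
    exact hgbd t
  have hlin : ∀ t : ℝ, g t = t • g 1 := fun t => by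
    have := map_real_smul G hG t 1
    simpa [G] using this
  refine ⟨g 1, ?_⟩
  rw [tendsto_iff_norm_sub_tendsto_zero]
  have h0 : Tendsto (fun t : ℝ => C / 2 * |t|) (𝓝[≠] 0) (𝓝 0) := by
    have : Tendsto (fun t : ℝ => C / 2 * |t|) (𝓝 0) (𝓝 (C / 2 * |0|)) :=
      (continuous_const.mul continuous_abs).tendsto 0
    simp only [abs_zero, mul_zero] at this
    exact this.mono_left nhdsWithin_le_nhds
  refine squeeze_zero' (Eventually.of_forall fun t => norm_nonneg _) ?_ h0
  filter_upwards [self_mem_nhdsWithin] with t ht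
  have ht : t ≠ 0 := ht
  have h1 : t⁻¹ • f t - g 1 = t⁻¹ • (f t - g t) := by
    rw [smul_sub, hlin t, smul_smul, inv_mul_cancel₀ ht, one_smul]
  rw [h1, norm_smul, norm_inv, Real.norm_eq_abs]
  refine (mul_le_mul_of_nonneg_left (hfg t) (by positivity)).trans (le_of_eq ?_)
  rw [← sq_abs]
  have : |t| ≠ 0 := abs_ne_zero.2 ht
  field_simp

variable {E V : Type*} [NormedAddCommGroup E] [InnerProductSpace ℝ E]
  [NormedAddCommGroup V] [NormedSpace ℝ V] {r : ℕ}

/-- The difference quotient `Δ_{tv} (p; α / t)`, extended linearly to pointed chains, as a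
pointed chain measured in the `(r + 1)`-norm. -/
def diffQuotient (v : E) (t : ℝ) : PointedChain E V r →ₗ[ℝ] PointedChain E V (r + 1) :=
  PointedChain.toFinsupp.symm.toLinearMap.comp
    ((difference (t • v)).comp (t⁻¹ • PointedChain.toFinsupp.toLinearMap))

theorem norm_diffQuotient_le (v : E) (t : ℝ) (A : PointedChain E V r) :
    ‖diffQuotient v t A‖ ≤ ‖v‖ * ‖A‖ := by
  refine (rNorm_difference_le r (t • v) (t⁻¹ • A.toFinsupp)).trans ?_
  refine (mul_le_mul_of_nonneg_left (rNorm_smul_le r t⁻¹ A.toFinsupp) (norm_nonneg _)).trans ?_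
  rw [norm_smul, norm_inv, ← PointedChain.norm_eq]
  by_cases ht : ‖t‖ = 0
  · simp only [ht, zero_mul]
    positivity
  · refine le_of_eq ?_
    field_simp

theorem exists_tendsto_diffQuotient (hr : 1 ≤ r) (v : E) (A : PointedChain E V r) :
    ∃ l, Tendsto (fun t : ℝ => (diffQuotient v t A : Chain E V (r + 1))) (𝓝[≠] 0) (𝓝 l) := by
  let c : (E →₀ V) →ₗ[ℝ] Chain E V (r + 1) :=
    (UniformSpace.Completion.toComplL (𝕜 := ℝ) (E := PointedChain E V (r + 1))).toLinearMap.comp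
      PointedChain.toFinsupp.symm.toLinearMap
  have hc : ∀ B : E →₀ V, ‖c B‖ = rNorm (r + 1) B := fun B =>
    UniformSpace.Completion.norm_coe (E := PointedChain E V (r + 1)) (PointedChain.toFinsupp.symm B)
  obtain ⟨q, rfl⟩ : ∃ q, r = q + 1 := ⟨r - 1, by omega⟩
  obtain ⟨l, hl⟩ := exists_tendsto_of_almost_additive
    (fun t : ℝ => c (difference (t • v) A.toFinsupp))
    (‖v‖ * ‖v‖ * rNorm q A.toFinsupp) (‖v‖ * rNorm (q + 1) A.toFinsupp) (by
      intro s t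
      rw [← map_sub, ← map_sub, add_smul, difference_add, hc, add_sub_right_comm,
        add_sub_right_comm, add_sub_cancel_left, sub_self, zero_add]
      refine (rNorm_difference_le (q + 1) _ _).trans ?_
      refine (mul_le_mul_of_nonneg_left (rNorm_difference_le q _ _) (norm_nonneg _)).trans ?_
      rw [norm_smul, norm_smul, Real.norm_eq_abs, Real.norm_eq_abs]
      refine le_of_eq (by ring)) (by
      intro t
      rw [hc]
      refine (rNorm_difference_le (q + 1) _ _).trans ?_
      rw [norm_smul, Real.norm_eq_abs]
      refine le_of_eq (by ring))
  refine ⟨l, hl.congr fun t => ?_⟩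
  rw [← map_smul, ← map_smul]
  rfl

/-- The prederivative `P_v (p; α) = lim_{t → 0} Δ_{tv} (p; α / t)`, a limit in the space of
chains of order `r + 1`, on pointed chains of order `r ≥ 1`. -/
def prederivativePointed (hr : 1 ≤ r) (v : E) :
    PointedChain E V r →L[ℝ] Chain E V (r + 1) :=
  LinearMap.mkContinuous
    { toFun := fun A =>
        limUnder (𝓝[≠] (0 : ℝ)) fun t => (diffQuotient v t A : Chain E V (r + 1))
      map_add' := fun A B => by
        refine Tendsto.limUnder_eq
          (((tendsto_nhds_limUnder (exists_tendsto_diffQuotient hr v A)).add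
            (tendsto_nhds_limUnder (exists_tendsto_diffQuotient hr v B))).congr fun t => ?_)
        rw [← UniformSpace.Completion.coe_add, map_add]
      map_smul' := fun a A => by
        refine Tendsto.limUnder_eq
          (((tendsto_nhds_limUnder (exists_tendsto_diffQuotient hr v A)).const_smul a).congr
            fun t => ?_)
        rw [← UniformSpace.Completion.coe_smul, map_smul] }
    ‖v‖ fun A =>
      le_of_tendsto (tendsto_nhds_limUnder (exists_tendsto_diffQuotient hr v A)).norm
        (Eventually.of_forall fun t =>
          (UniformSpace.Completion.norm_coe _).trans_le (norm_diffQuotient_le v t A))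

theorem tendsto_prederivativePointed (hr : 1 ≤ r) (v : E) (A : PointedChain E V r) :
    Tendsto (fun t : ℝ => (diffQuotient v t A : Chain E V (r + 1))) (𝓝[≠] 0)
      (𝓝 (prederivativePointed hr v A)) :=
  tendsto_nhds_limUnder (exists_tendsto_diffQuotient hr v A)

/-- The prederivative `P_v` from chains of order `r ≥ 1` to chains of order `r + 1`. -/
def prederivative (hr : 1 ≤ r) (v : E) : Chain E V r →L[ℝ] Chain E V (r + 1) :=
  Chain.extend (prederivativePointed hr v)

/-- Retraction `E_v† (p; w) = (p; ⟪v, w⟫)` of `1`-chains to `0`-chains, on finitely supported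
functions. -/
def retractionFinsupp (v : E) : (E →₀ E) →ₗ[ℝ] (E →₀ ℝ) :=
  Finsupp.mapRange.linearMap (innerₗ E v)

theorem retractionFinsupp_diffChain (v : E) (U : List E) (p : E) (w : E) :
    retractionFinsupp v (diffChain U p w) = diffChain U p (inner ℝ v w) := by
  induction U with
  | nil => simp [diffChain, retractionFinsupp]
  | cons u U ih =>
    have h : ∀ A : E →₀ E,
        retractionFinsupp v (difference u A) = difference u (retractionFinsupp v A) := by
      intro A
      induction A using Finsupp.induction_linear with
      | zero => simp
      | add A B hA hB => simp only [map_add, hA, hB]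
      | single p w =>
        simp only [difference, LinearMap.sub_apply, map_sub]
        simp [translate, retractionFinsupp]
    simp only [diffChain, List.foldr_cons] at ih ⊢
    rw [h, ih]

theorem rNorm_retractionFinsupp_le (v : E) (A : E →₀ E) :
    rNorm r (retractionFinsupp v A) ≤ ‖v‖ * rNorm r A := by
  refine le_rNorm_of_diffChain (F := PointedChain E ℝ r)
    (PointedChain.toFinsupp.symm.toLinearMap.comp (retractionFinsupp v)).toAddMonoidHom
    ‖v‖ (norm_nonneg _) ?_ A
  intro U p w hU
  have h1 : rNorm r (retractionFinsupp v (diffChain U p w)) ≤ ‖v‖ * diffSize U w := by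
    rw [retractionFinsupp_diffChain]
    refine (rNorm_le (costs_diffChain hU p _)).trans ?_
    simp only [diffSize]
    rw [mul_left_comm]
    refine mul_le_mul_of_nonneg_left (norm_inner_le_norm v w) (List.prod_nonneg ?_)
    intro a ha
    obtain ⟨u, -, rfl⟩ := List.mem_map.1 ha
    exact norm_nonneg _
  exact h1

/-- Retraction `E_v†` as a continuous operator on pointed `1`-chains. -/
def retractionPointed (v : E) : PointedChain E E r →L[ℝ] PointedChain E ℝ r :=
  LinearMap.mkContinuous
    (PointedChain.toFinsupp.symm.toLinearMap.comp
      ((retractionFinsupp v).comp PointedChain.toFinsupp.toLinearMap))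
    ‖v‖ fun A => rNorm_retractionFinsupp_le v A.toFinsupp

/-- Retraction `E_v†` from differential `1`-chains to differential `0`-chains. -/
def retraction (v : E) : Chain E E r →L[ℝ] Chain E ℝ r :=
  Chain.extend (UniformSpace.Completion.toComplL.comp (retractionPointed v))

/-- The boundary operator `∂ = ∑ᵢ P_{vᵢ} ∘ E_{vᵢ}†` from `1`-chains of order `r ≥ 1` to
`0`-chains of order `r + 1`, where `(vᵢ)` is an orthonormal basis of `E`. -/
def boundary [FiniteDimensional ℝ E] (hr : 1 ≤ r) : Chain E E r →L[ℝ] Chain E ℝ (r + 1) :=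
  ∑ i, (prederivative hr (stdOrthonormalBasis ℝ E i)).comp
    (retraction (stdOrthonormalBasis ℝ E i))

end Boundary

/-- `∫_J g(z) dz = c`, where `J` is a real `1`-chain on `ℂ = ℝ²`: writing `g = u + iv`, the
Harrison integral of `u dx - v dy` over `J` is `Re c` and that of `v dx + u dy` is `Im c`. -/
def HasComplexIntegral {r : ℕ} (J : Chain ℂ ℂ r) (g : ℂ → ℂ) (c : ℂ) : Prop :=
  HasIntegral J (fun z => (g z).re • Complex.reLm - (g z).im • Complex.imLm) c.re ∧
    HasIntegral J (fun z => (g z).im • Complex.reLm + (g z).re • Complex.imLm) c.im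

end Harrison

end

/-! A contractible open set is simply connected, so `f` has a primitive `F` on `U`
(`isExactOn_of_simplyConnectedSpace`), and the real and imaginary parts of `f dz` are `d(Re F)` and
`d(Im F)`. The support of `J` is a closed subset of a bounded set, hence compact, so a cutoff
extends each part of `F` from a neighbourhood of it to a smooth compactly supported `g`. Such a `g`
and its derivative have bounded difference quotients of all orders, so Stokes (`integral_boundary`)
gives `∫_J dg = ∫_{∂J} g = 0`.

The value must not depend on the extension. This is `integral_eq_zero_of_eventually`: a form
vanishing near `supp J` integrates to zero. The support is only an intersection of supporting closed
sets, and it is not assumed to support `J` itself. Locality is therefore proved first near single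
points off the support, then on compact sets by multiplying cutoffs, and finally on the whole space
by approximating `J` with finitely supported chains. -/

noncomputable section

namespace Harrison

/-! ### Iterated differences of functions and their bounds. -/

section DifferencesOfFunctions

variable {E W : Type*} [NormedAddCommGroup E] [NormedAddCommGroup W]

/-- The iterated difference `Δ_{u₁} ⋯ Δ_{u_j} g` of a function, where `Δ_u g = g (· + u) - g`. -/
def diffFun : List E → (E → W) → E → W
  | [], g => g
  | u :: U, g => diffFun U fun p => g (p + u) - g p

@[simp] theorem diffFun_nil (g : E → W) : diffFun [] g = g := rfl

theorem diffFun_cons (u : E) (U : List E) (g : E → W) :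
    diffFun (u :: U) g = diffFun U fun p => g (p + u) - g p := rfl

theorem diffFun_add (U : List E) (f g : E → W) :
    diffFun U (fun p => f p + g p) = fun p => diffFun U f p + diffFun U g p := by
  induction U generalizing f g with
  | nil => rfl
  | cons u U ih => simp only [diffFun_cons, ← ih]; congr 1; funext p; abel

theorem diffFun_sub (U : List E) (f g : E → W) :
    diffFun U (fun p => f p - g p) = fun p => diffFun U f p - diffFun U g p := by
  induction U generalizing f g with
  | nil => rfl
  | cons u U ih => simp only [diffFun_cons, ← ih]; congr 1; funext p; abel

theorem diffFun_translate (U : List E) (v : E) (g : E → W) :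
    diffFun U (fun p => g (p + v)) = fun p => diffFun U g (p + v) := by
  induction U generalizing g with
  | nil => rfl
  | cons u U ih =>
    simp only [diffFun_cons, ← ih]
    congr 1; funext p; rw [add_right_comm]

/-- Differences commute with translations, so the first increment may also be applied last. In this
form `g` stays fixed during inductions on the list. -/
theorem diffFun_cons_apply (u : E) (U : List E) (g : E → W) (p : E) :
    diffFun (u :: U) g p = diffFun U g (p + u) - diffFun U g p := by
  rw [diffFun_cons, diffFun_sub, diffFun_translate]

theorem diffFun_map_apply {F W' : Type*} [NormedAddCommGroup W'] [FunLike F W W']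
    [AddMonoidHomClass F W W'] (L : F) (U : List E) (g : E → W) (p : E) :
    diffFun U (fun q => L (g q)) p = L (diffFun U g p) := by
  induction U generalizing p with
  | nil => rfl
  | cons u U ih => simp only [diffFun_cons_apply, ih, map_sub]

theorem diffFun_comp_smul [NormedSpace ℝ E] (c : ℝ) (U : List E) (g : E → W) (p : E) :
    diffFun U (fun q => g (c • q)) p = diffFun (U.map (c • ·)) g (c • p) := by
  induction U generalizing p with
  | nil => rfl
  | cons u U ih => simp only [List.map_cons, diffFun_cons_apply, ih, smul_add]

/-- All iterated differences of `g` of order `j ≤ r` are bounded by `C ‖u₁‖ ⋯ ‖u_j‖`. -/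
def DiffBounded (r : ℕ) (C : ℝ) (g : E → W) : Prop :=
  ∀ (U : List E) (p : E), U.length ≤ r → ‖diffFun U g p‖ ≤ C * (U.map fun u => ‖u‖).prod

theorem diffBounded_zero_iff {C : ℝ} {g : E → W} : DiffBounded 0 C g ↔ ∀ p, ‖g p‖ ≤ C := by
  refine ⟨fun h p => by simpa using h [] p le_rfl, fun h U p hU => ?_⟩
  obtain rfl := List.length_eq_zero_iff.1 (Nat.le_zero.1 hU)
  simpa using h p

/-- This drives the inductions on `r`: one difference lowers the order by one and puts a factor
`‖u‖` into the constant. -/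
theorem diffBounded_succ_iff {r : ℕ} {C : ℝ} {g : E → W} :
    DiffBounded (r + 1) C g ↔
      (∀ p, ‖g p‖ ≤ C) ∧ ∀ u, DiffBounded r (C * ‖u‖) fun p => g (p + u) - g p := by
  constructor
  · refine fun h => ⟨fun p => by simpa using h [] p (by simp), fun u U p hU => ?_⟩
    simpa [diffFun_cons, mul_assoc] using h (u :: U) p (by simpa using hU)
  · rintro ⟨h0, h1⟩ U p hU
    cases U with
    | nil => simpa using h0 p
    | cons u U => simpa [diffFun_cons, mul_assoc] using h1 u U p (by simpa using hU)

theorem prod_map_norm_nonneg (U : List E) : 0 ≤ (U.map fun u => ‖u‖).prod :=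
  List.prod_nonneg fun a ha => by
    obtain ⟨u, -, rfl⟩ := List.mem_map.1 ha
    exact norm_nonneg _

namespace DiffBounded

variable {r : ℕ} {C D : ℝ} {f g : E → W}

theorem nonneg (h : DiffBounded r C g) : 0 ≤ C :=
  (norm_nonneg _).trans (by simpa using h [] 0 (by simp))

theorem of_succ (h : DiffBounded (r + 1) C g) : DiffBounded r C g :=
  fun U p hU => h U p (by omega)

theorem mono (h : DiffBounded r C g) (hCD : C ≤ D) : DiffBounded r D g :=
  fun U p hU => (h U p hU).trans
    (mul_le_mul_of_nonneg_right hCD (prod_map_norm_nonneg U))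

theorem add (hf : DiffBounded r C f) (hg : DiffBounded r D g) :
    DiffBounded r (C + D) fun p => f p + g p := fun U p hU => by
  rw [diffFun_add, add_mul]
  exact (norm_add_le _ _).trans (add_le_add (hf U p hU) (hg U p hU))

theorem sub (hf : DiffBounded r C f) (hg : DiffBounded r D g) :
    DiffBounded r (C + D) fun p => f p - g p := fun U p hU => by
  rw [diffFun_sub, add_mul]
  exact (norm_sub_le _ _).trans (add_le_add (hf U p hU) (hg U p hU))

theorem translate (hg : DiffBounded r C g) (v : E) : DiffBounded r C fun p => g (p + v) :=
  fun U p hU => by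
    rw [diffFun_translate]
    exact hg U (p + v) hU

/-- Discrete Leibniz rule: `Δ_u (f g) = (Δ_u f) (T_u g) + f (Δ_u g)`. Each order produces two terms,
whence the factor `2 ^ r`. -/
theorem smul [NormedSpace ℝ W] {f : E → ℝ} (hf : DiffBounded r C f) (hg : DiffBounded r D g) :
    DiffBounded r (2 ^ r * C * D) fun p => f p • g p := by
  induction r generalizing C D f g with
  | zero =>
    rw [diffBounded_zero_iff] at *
    intro p
    rw [norm_smul, pow_zero, one_mul]
    exact mul_le_mul (hf p) (hg p) (norm_nonneg _) ((norm_nonneg _).trans (hf p))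
  | succ r ih =>
    have hC := hf.nonneg
    have hD := hg.nonneg
    have hf' := diffBounded_succ_iff.1 hf
    have hg' := diffBounded_succ_iff.1 hg
    refine diffBounded_succ_iff.2 ⟨fun p => ?_, fun u => ?_⟩
    · rw [norm_smul]
      refine (mul_le_mul (hf'.1 p) (hg'.1 p) (norm_nonneg _) hC).trans ?_
      rw [mul_assoc]
      exact le_mul_of_one_le_left (by positivity) (one_le_pow₀ (by norm_num))
    · have h := (ih (hf'.2 u) (hg.of_succ.translate u)).add (ih hf.of_succ (hg'.2 u))
      have e : (fun p => f (p + u) • g (p + u) - f p • g p) =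
          fun p => (f (p + u) - f p) • g (p + u) + f p • (g (p + u) - g p) := by
        funext p
        simp only [sub_smul, smul_sub]
        abel
      rw [e]
      exact h.mono (le_of_eq (by ring))

/-- Scaling by `c` only shrinks the increments. The constant does not depend on `c`, so the cutoffs
`χ (R⁻¹ • p)` share one bound for all `R ≥ 1`. -/
theorem comp_smul [NormedSpace ℝ E] (hg : DiffBounded r C g) {c : ℝ} (hc : |c| ≤ 1) :
    DiffBounded r C fun p => g (c • p) := by
  intro U p hU
  rw [diffFun_comp_smul]
  refine (hg _ _ (by simpa using hU)).trans (mul_le_mul_of_nonneg_left ?_ hg.nonneg)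
  rw [List.map_map]
  refine List.prod_map_le_prod_map₀ _ _ (fun u _ => norm_nonneg _) fun u _ => ?_
  simp only [Function.comp, norm_smul, Real.norm_eq_abs]
  exact mul_le_of_le_one_left (norm_nonneg _) hc

end DiffBounded

theorem diffBounded_const (r : ℕ) (w : W) : DiffBounded r ‖w‖ fun _ : E => w := by
  intro U p hU
  cases U with
  | nil => simp
  | cons u U =>
    rw [diffFun_cons_apply]
    have h := diffFun_translate (E := E) U u fun _ => w
    rw [← congrFun h p, sub_self, norm_zero]
    exact mul_nonneg (norm_nonneg _) (prod_map_norm_nonneg _)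

end DifferencesOfFunctions

theorem hasFDerivAt_diffFun {E W : Type*} [NormedAddCommGroup E] [NormedSpace ℝ E]
    [NormedAddCommGroup W] [NormedSpace ℝ W] {g : E → W} {g' : E → E →L[ℝ] W}
    (hg : ∀ p, HasFDerivAt g (g' p) p) (U : List E) (p : E) :
    HasFDerivAt (diffFun U g) (diffFun U g' p) p := by
  induction U generalizing p with
  | nil => exact hg p
  | cons u U ih =>
    have e : diffFun (u :: U) g = fun p => diffFun U g (p + u) - diffFun U g p :=
      funext (diffFun_cons_apply u U g)
    rw [e, diffFun_cons_apply]
    exact ((hasFDerivAt_comp_add_right u).2 (ih (p + u))).sub (ih p)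

/-- Smooth functions with compact support have bounded difference quotients of every order. -/
theorem exists_diffBounded_of_hasCompactSupport {E W : Type} [NormedAddCommGroup E]
    [NormedSpace ℝ E] [NormedAddCommGroup W] [NormedSpace ℝ W] (r : ℕ) {g : E → W}
    (hg : ContDiff ℝ (⊤ : ℕ∞) g) (hs : HasCompactSupport g) : ∃ C, DiffBounded r C g := by
  induction r generalizing W with
  | zero =>
    obtain ⟨C, hC⟩ := hs.exists_bound_of_continuous hg.continuous
    exact ⟨C, diffBounded_zero_iff.2 hC⟩
  | succ r ih =>
    obtain ⟨C, hC⟩ := hs.exists_bound_of_continuous hg.continuous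
    -- The induction hypothesis is used for the derivative, with values in `E →L[ℝ] W`; this is why
    -- `W` is generalized and shares a universe with `E`.
    obtain ⟨D, hD⟩ := ih (hg.fderiv_right (m := (⊤ : ℕ∞)) (by simp)) (hs.fderiv (𝕜 := ℝ))
    refine ⟨max C D, diffBounded_succ_iff.2
      ⟨fun p => (hC p).trans (le_max_left _ _), fun u U p hU => ?_⟩⟩
    have hder : ∀ q, HasFDerivAt g (fderiv ℝ g q) q := fun q =>
      (hg.differentiable (by simp) q).hasFDerivAt
    -- Mean value inequality for `diffFun U g` between `p` and `p + u`: its derivative is `diffFun U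
    -- (fderiv ℝ g)`, already bounded through `D`.
    have h := convex_univ.norm_image_sub_le_of_norm_hasFDerivWithin_le (𝕜 := ℝ) (x := p)
      (y := p + u) (fun q _ => (hasFDerivAt_diffFun hder U q).hasFDerivWithinAt)
      (fun q _ => hD U q hU) trivial trivial
    rw [← diffFun_cons, diffFun_cons_apply]
    refine h.trans ?_
    rw [add_sub_cancel_left, mul_right_comm]
    exact mul_le_mul_of_nonneg_right
      (mul_le_mul_of_nonneg_right (le_max_right _ _) (norm_nonneg _)) (prod_map_norm_nonneg U)

/-! ### Forms of class `B^r` and linearity and continuity of the integral. -/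

section Forms

variable {E V : Type*} [NormedAddCommGroup E] [NormedAddCommGroup V] [NormedSpace ℝ V] {r : ℕ}

theorem lsum_difference (ω : E → V →ₗ[ℝ] ℝ) (u : E) (A : E →₀ V) :
    Finsupp.lsum ℝ ω (difference u A) = Finsupp.lsum ℝ (fun p => ω (p + u) - ω p) A := by
  induction A using Finsupp.induction_linear with
  | zero => simp
  | add A B hA hB => simp only [map_add, hA, hB]
  | single p α => simp [difference, translate, Finsupp.sum_sub_index]

/-- Duality: each difference moves from the chain to the coefficients of the form, so membership in
`B^r` becomes a bound on difference quotients of functions. -/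
theorem lsum_diffChain (ω : E → V →ₗ[ℝ] ℝ) (U : List E) (p : E) (α : V) :
    Finsupp.lsum ℝ ω (diffChain U p α) = diffFun U (fun q => ω q α) p := by
  induction U generalizing ω with
  | nil => simp [diffChain]
  | cons u U ih =>
    have h : diffChain (u :: U) p α = difference u (diffChain U p α) := rfl
    rw [h, lsum_difference, ih, diffFun_cons]
    rfl

theorem DiffBounded.abs_lsum_diffChain_le {ω : E → V →ₗ[ℝ] ℝ} {C : ℝ}
    (h : ∀ α, DiffBounded r (C * ‖α‖) fun q => ω q α) (U : List E) (p : E) (α : V)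
    (hU : U.length ≤ r) :
    |Finsupp.lsum ℝ ω (diffChain U p α)| ≤ C * diffSize U α := by
  rw [lsum_diffChain, ← Real.norm_eq_abs]
  refine (h α U p hU).trans (le_of_eq ?_)
  rw [diffSize]
  ring

/-- A form whose coefficients have bounded difference quotients. -/
def BForm.ofDiffBounded (ω : E → V →ₗ[ℝ] ℝ)
    (h : ∃ C : ℝ, ∀ α, DiffBounded r (C * ‖α‖) fun q => ω q α) : BForm E V r where
  toFun := ω
  bounded := by
    obtain ⟨C, hC⟩ := h
    exact ⟨C, DiffBounded.abs_lsum_diffChain_le hC⟩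

theorem BForm.exists_diffBounded (ω : BForm E V r) :
    ∃ C : ℝ, 0 ≤ C ∧ ∀ α, DiffBounded r (C * ‖α‖) fun q => ω.toFun q α := by
  obtain ⟨C, hC⟩ := ω.bounded
  refine ⟨max C 0, le_max_right _ _, fun α U p hU => ?_⟩
  rw [← lsum_diffChain, Real.norm_eq_abs]
  refine (hC U p α hU).trans
    ((mul_le_mul_of_nonneg_right (le_max_left C 0) (diffSize_nonneg _ _)).trans (le_of_eq ?_))
  rw [diffSize]
  ring

theorem DiffBounded.mulForm {ω : E → V →ₗ[ℝ] ℝ} {C D : ℝ} {φ : E → ℝ} (hφ : DiffBounded r C φ)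
    (h : ∀ α, DiffBounded r (D * ‖α‖) fun q => ω q α) (α : V) :
    DiffBounded r (2 ^ r * C * D * ‖α‖) fun q => (φ q • ω q) α := by
  simpa only [mul_assoc, LinearMap.smul_apply] using hφ.smul (h α)

/-- The product of a function and a form, both with bounded difference quotients. -/
def BForm.mul (φ : E → ℝ) (hφ : ∃ C, DiffBounded r C φ) (ω : BForm E V r) : BForm E V r :=
  BForm.ofDiffBounded (fun p => φ p • ω.toFun p) (by
    obtain ⟨C, hC⟩ := hφ
    obtain ⟨D, -, hD⟩ := ω.exists_diffBounded
    exact ⟨_, hC.mulForm hD⟩)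

@[simp] theorem BForm.mul_toFun (φ : E → ℝ) (hφ : ∃ C, DiffBounded r C φ) (ω : BForm E V r)
    (p : E) : (BForm.mul φ hφ ω).toFun p = φ p • ω.toFun p := rfl

theorem integral_coe (A : PointedChain E V r) (ω : BForm E V r) :
    integral (A : Chain E V r) ω = ω.eval A :=
  Chain.extend_coe _ _

theorem continuous_integral (ω : BForm E V r) : Continuous fun J : Chain E V r => integral J ω :=
  (Chain.extend ω.eval).continuous

theorem integral_sub_chain (J K : Chain E V r) (ω : BForm E V r) :
    integral (J - K) ω = integral J ω - integral K ω :=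
  map_sub (Chain.extend ω.eval) J K

/-- Continuity with an explicit constant, needed to estimate a whole family of truncated forms
uniformly. -/
theorem abs_integral_le {ω : BForm E V r} {C : ℝ} (hC : 0 ≤ C)
    (h : ∀ α, DiffBounded r (C * ‖α‖) fun q => ω.toFun q α) (J : Chain E V r) :
    |integral J ω| ≤ C * ‖J‖ := by
  induction J using UniformSpace.Completion.induction_on with
  | hp => exact isClosed_le (continuous_integral ω).abs (continuous_const.mul continuous_norm)
  | ih A =>
    rw [integral_coe, UniformSpace.Completion.norm_coe]
    exact le_rNorm_of_diffChain (Finsupp.lsum ℝ ω.toFun).toAddMonoidHom C hC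
      (DiffBounded.abs_lsum_diffChain_le h) A.toFinsupp

theorem integral_add_chain (J K : Chain E V r) (ω : BForm E V r) :
    integral (J + K) ω = integral J ω + integral K ω :=
  map_add (Chain.extend ω.eval) J K

/-- The Harrison integral is linear in the form. -/
theorem integral_linear {ω ω₁ ω₂ : BForm E V r} {a b : ℝ}
    (h : ∀ p, ω.toFun p = a • ω₁.toFun p + b • ω₂.toFun p) (J : Chain E V r) :
    integral J ω = a * integral J ω₁ + b * integral J ω₂ := by
  induction J using UniformSpace.Completion.induction_on with
  | hp =>
    exact isClosed_eq (continuous_integral ω) ((continuous_const.mul (continuous_integral ω₁)).add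
      (continuous_const.mul (continuous_integral ω₂)))
  | ih A =>
    simp only [integral_coe, BForm.eval_apply, h, Finsupp.sum, Finset.mul_sum,
      ← Finset.sum_add_distrib]
    rfl

theorem integral_coe_congr {ω₁ ω₂ : BForm E V r} (A : PointedChain E V r)
    (h : ∀ p ∈ A.points, ω₁.toFun p = ω₂.toFun p) :
    integral (A : Chain E V r) ω₁ = integral (A : Chain E V r) ω₂ := by
  rw [integral_coe, integral_coe, BForm.eval_apply, BForm.eval_apply]
  exact Finsupp.sum_congr fun p hp => by rw [h p hp]

/-- The difference of two forms in `B^r` is in `B^r`. -/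
theorem BForm.exists_sub (ω₁ ω₂ : BForm E V r) :
    ∃ ω : BForm E V r, ∀ p, ω.toFun p = ω₁.toFun p - ω₂.toFun p := by
  obtain ⟨C, -, hC⟩ := ω₁.exists_diffBounded
  obtain ⟨D, -, hD⟩ := ω₂.exists_diffBounded
  exact ⟨BForm.ofDiffBounded (fun p => ω₁.toFun p - ω₂.toFun p) ⟨C + D, fun α => by
    simpa only [add_mul, LinearMap.sub_apply] using (hC α).sub (hD α)⟩, fun p => rfl⟩

end Forms

/-! ### Locality: the integral depends only on the form near the support. -/

section Support

variable {E : Type} {V : Type*} [NormedAddCommGroup E]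
  [NormedAddCommGroup V] [NormedSpace ℝ V] {r : ℕ}

theorem integral_eq_zero_of_forall {ω : BForm E V r} (h : ∀ p, ω.toFun p = 0)
    (J : Chain E V r) : integral J ω = 0 := by
  simpa using integral_linear (ω₁ := ω) (ω₂ := ω) (a := 0) (b := 0) (by simpa using h) J

variable [NormedSpace ℝ E]

/-- Away from its support, a chain vanishes on all forms concentrated near a given point. -/
theorem exists_integral_eq_zero_of_notMem_supp [Nontrivial E] {J : Chain E V r} {p : E}
    (hp : p ∉ J.supp) :
    ∃ δ > 0, ∀ ω : BForm E V r, (∀ q ∉ Metric.closedBall p δ, ω.toFun q = 0) →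
      integral J ω = 0 := by
  simp only [Chain.supp, Set.mem_sInter, not_forall] at hp
  obtain ⟨X, ⟨hX, hJ⟩, hpX⟩ := hp
  obtain ⟨δ, hδ, hball⟩ := Metric.nhds_basis_closedBall.mem_iff.1 (hX.isOpen_compl.mem_nhds hpX)
  refine ⟨δ, hδ, fun ω hω => ?_⟩
  -- Supporting sets are tested only on non-empty open sets; here a ball is not the whole space
  -- because `E` is unbounded.
  have hne : (Metric.closedBall p δ)ᶜ.Nonempty := by
    rw [Set.nonempty_compl]
    intro h
    exact NormedSpace.unbounded_univ ℝ E (h ▸ Metric.isBounded_closedBall)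
  obtain ⟨A, hA, hlim⟩ := hJ _ Metric.isClosed_closedBall.isOpen_compl hne
    (Set.subset_compl_comm.1 hball)
  have h1 : Tendsto (fun i => integral (A i : Chain E V r) ω) atTop (𝓝 (integral J ω)) :=
    ((continuous_integral ω).tendsto J).comp hlim
  have h2 : ∀ i, integral (A i : Chain E V r) ω = 0 := fun i => by
    rw [integral_coe, BForm.eval_apply]
    exact Finset.sum_eq_zero fun q hq => by
      simp only [hω q (hA i hq), LinearMap.zero_apply]
  simp only [h2] at h1
  exact (tendsto_nhds_unique h1 tendsto_const_nhds)

variable [HasContDiffBump E] [FiniteDimensional ℝ E]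

theorem exists_diffBounded_contDiffBump (r : ℕ) {c : E} (φ : ContDiffBump c) :
    ∃ C, DiffBounded r C φ :=
  exists_diffBounded_of_hasCompactSupport r φ.contDiff φ.hasCompactSupport

/-- A compact set disjoint from the support of `J` can be cut out of every form without changing
its integral over `J`. -/
theorem exists_mul_integral_eq [Nontrivial E] (J : Chain E V r) {S : Set E} (hS : IsCompact S)
    (hJ : ∀ p ∈ S, p ∉ J.supp) :
    ∃ (φ : E → ℝ) (hφ : ∃ C, DiffBounded r C φ), (∀ p ∈ S, φ p = 0) ∧
      ∀ ω : BForm E V r, integral J (BForm.mul φ hφ ω) = integral J ω := by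
  have hone : ∃ C, DiffBounded r C fun _ : E => (1 : ℝ) := ⟨_, diffBounded_const r 1⟩
  -- Compactness reduces the claim to small neighbourhoods: cutoffs for two sets multiply to one for
  -- their union, and near a point `1 - φ` works for a bump `φ` so concentrated that `J` annihilates
  -- `φ ω`.
  refine hS.induction_on (p := fun S => ∃ (φ : E → ℝ) (hφ : ∃ C, DiffBounded r C φ),
    (∀ p ∈ S, φ p = 0) ∧ ∀ ω : BForm E V r, integral J (BForm.mul φ hφ ω) = integral J ω)
    ?_ ?_ ?_ ?_
  · refine ⟨_, hone, by simp, fun ω => ?_⟩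
    simpa using integral_linear (ω := BForm.mul _ hone ω) (ω₁ := ω) (ω₂ := ω) (a := 1) (b := 0)
      (by simp) J
  · rintro S T hST ⟨φ, hφ, h0, h1⟩
    exact ⟨φ, hφ, fun p hp => h0 p (hST hp), h1⟩
  · rintro S T ⟨φ, hφ, h0, h1⟩ ⟨ψ, hψ, k0, k1⟩
    have hφψ : ∃ C, DiffBounded r C fun p => φ p • ψ p := by
      obtain ⟨C, hC⟩ := hφ
      obtain ⟨D, hD⟩ := hψ
      exact ⟨_, hC.smul hD⟩
    refine ⟨_, hφψ, ?_, fun ω => ?_⟩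
    · rintro p (hp | hp)
      · simp [h0 p hp]
      · simp [k0 p hp]
    · rw [← k1 ω, ← h1 (BForm.mul ψ hψ ω)]
      simpa using integral_linear (ω := BForm.mul _ hφψ ω)
        (ω₁ := BForm.mul φ hφ (BForm.mul ψ hψ ω)) (ω₂ := ω) (a := 1) (b := 0)
        (by simp [smul_smul]) J
  · intro p hp
    obtain ⟨δ, hδ, hkill⟩ := exists_integral_eq_zero_of_notMem_supp (hJ p hp)
    let φ : ContDiffBump p := ⟨δ / 2, δ, by positivity, by linarith⟩
    have hφ : ∃ C, DiffBounded r C φ := exists_diffBounded_contDiffBump r φ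
    have hψ : ∃ C, DiffBounded r C fun q => 1 - φ q := by
      obtain ⟨C, hC⟩ := hφ
      obtain ⟨D, hD⟩ := hone
      exact ⟨_, hD.sub hC⟩
    refine ⟨Metric.closedBall p (δ / 2), mem_nhdsWithin_of_mem_nhds
      (Metric.closedBall_mem_nhds p (by positivity)), _, hψ, fun q hq => ?_, fun ω => ?_⟩
    · rw [φ.one_of_mem_closedBall hq, sub_self]
    · have h0 : integral J (BForm.mul φ hφ ω) = 0 := hkill _ fun q hq => by
        rw [BForm.mul_toFun, φ.zero_of_le_dist (by
          rw [Metric.mem_closedBall, not_le] at hq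
          exact hq.le), zero_smul]
      have h1 := integral_linear (ω := BForm.mul _ hψ ω) (ω₁ := ω) (ω₂ := BForm.mul φ hφ ω)
        (a := 1) (b := -1) (by intro q; simp only [BForm.mul_toFun]; module) J
      rw [h1, h0]
      ring

/-- A form vanishing near the support of a chain has integral zero over that chain. -/
theorem integral_eq_zero_of_eventually [Nontrivial E] {J : Chain E V r} {ω : BForm E V r}
    (h : ∀ᶠ p in 𝓝ˢ J.supp, ω.toFun p = 0) : integral J ω = 0 := by
  obtain ⟨N, hN, hJN, hωN⟩ := mem_nhdsSet_iff_exists.1 h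
  let χ : ContDiffBump (0 : E) := ⟨1, 2, one_pos, one_lt_two⟩
  obtain ⟨B, hB⟩ := exists_diffBounded_contDiffBump r χ
  have hχ : ∀ R : ℝ, 1 ≤ R → DiffBounded r B fun p => χ (R⁻¹ • p) := fun R hR =>
    hB.comp_smul (by
      rw [abs_of_pos (by positivity)]
      exact inv_le_one_of_one_le₀ hR)
  obtain ⟨C, hC, hωC⟩ := ω.exists_diffBounded
  -- The truncated form vanishes on `N` and outside the ball of radius `2 * R`. What remains is a
  -- compact set missing the support, and `φ` removes it without changing the integral.
  have hcut : ∀ (R : ℝ) (hR : 1 ≤ R), integral J (BForm.mul _ ⟨B, hχ R hR⟩ ω) = 0 := by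
    intro R hR
    have hR0 : 0 < R := by positivity
    obtain ⟨φ, hφ, h0, h1⟩ := exists_mul_integral_eq J
      ((isCompact_closedBall (0 : E) (2 * R)).diff hN) fun p hp hpJ => hp.2 (hJN hpJ)
    rw [← h1]
    refine integral_eq_zero_of_forall (fun p => ?_) J
    simp only [BForm.mul_toFun]
    by_cases hpN : p ∈ N
    · have : ω.toFun p = 0 := hωN hpN
      rw [this, smul_zero, smul_zero]
    · by_cases hpR : p ∈ Metric.closedBall (0 : E) (2 * R)
      · rw [h0 p ⟨hpR, hpN⟩, zero_smul]
      · rw [χ.zero_of_le_dist, zero_smul, smul_zero]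
        rw [mem_closedBall_zero_iff, not_le] at hpR
        rw [dist_zero_right, norm_smul, norm_inv, Real.norm_of_nonneg hR0.le, inv_mul_eq_div,
          le_div_iff₀ hR0]
        exact hpR.le
  have hD : 0 ≤ 2 ^ r * B * C := mul_nonneg (mul_nonneg (by positivity) hB.nonneg) hC
  -- Take `A` within `ε` of `J` and `R` so large that truncation is invisible on `A`. The integrals
  -- of `ω` and its truncation agree on `A`, and the latter vanishes on `J`, so `∫_J ω` is the
  -- difference of their integrals over `J - A`. The bound is free of `R`.
  have key : ∀ ε > 0, |integral J ω| ≤ (C + 2 ^ r * B * C) * ε := by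
    intro ε hε
    obtain ⟨A, hA⟩ := UniformSpace.Completion.denseRange_coe.exists_dist_lt J hε
    obtain ⟨R, hR⟩ := (A.toFinsupp.support.finite_toSet.isBounded).subset_closedBall (0 : E)
    have hR1 : 1 ≤ max R 1 := le_max_right _ _
    have hAeq : integral (A : Chain E V r) (BForm.mul _ ⟨B, hχ _ hR1⟩ ω) =
        integral (A : Chain E V r) ω := by
      refine integral_coe_congr A fun p hp => ?_
      rw [BForm.mul_toFun, χ.one_of_mem_closedBall, one_smul]
      have hp' := mem_closedBall_zero_iff.1 (hR hp)
      rw [mem_closedBall_zero_iff, norm_smul, norm_inv, Real.norm_of_nonneg (by positivity),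
        inv_mul_eq_div]
      exact (div_le_one (by positivity)).2 (hp'.trans (le_max_left _ _))
    have e1 := abs_integral_le hC hωC (J - A)
    have e2 := abs_integral_le (ω := BForm.mul _ ⟨B, hχ _ hR1⟩ ω) hD ((hχ _ hR1).mulForm hωC)
      (J - A)
    rw [integral_sub_chain, hcut _ hR1, hAeq] at e2
    rw [integral_sub_chain] at e1
    rw [dist_eq_norm] at hA
    have e3 : C * ‖J - A‖ ≤ C * ε := mul_le_mul_of_nonneg_left hA.le hC
    have e4 := mul_le_mul_of_nonneg_left hA.le hD
    rw [abs_le] at *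
    constructor <;> linarith
  by_contra hne
  have hpos : 0 < |integral J ω| := abs_pos.2 hne
  set M := C + 2 ^ r * B * C with hM
  have hM0 : 0 ≤ M := add_nonneg hC hD
  -- This `ε` would make the nonzero `|∫_J ω|` at most half of itself; `M + 1` covers the case `M =
  -- 0`.
  have := key (|integral J ω| / (2 * (M + 1))) (by positivity)
  rw [mul_div_assoc', le_div_iff₀ (by positivity)] at this
  nlinarith

/-- To show that an integral is well defined it suffices to compute it for one form. -/
theorem HasIntegral.of_form [Nontrivial E] {J : Chain E V r} {η : E → V →ₗ[ℝ] ℝ} {c : ℝ}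
    (ω : BForm E V r) (hω : ∀ᶠ p in 𝓝ˢ J.supp, ω.toFun p = η p) (hc : integral J ω = c) :
    HasIntegral J η c := by
  refine ⟨⟨ω, hω⟩, fun ω' hω' => ?_⟩
  obtain ⟨τ, hτ⟩ := BForm.exists_sub ω' ω
  have h0 : integral J τ = 0 := integral_eq_zero_of_eventually (by
    filter_upwards [hω, hω'] with p h1 h2
    rw [hτ, h1, h2, sub_self])
  have h1 := integral_linear (ω := τ) (ω₁ := ω') (ω₂ := ω) (a := 1) (b := -1)
    (by intro p; rw [hτ]; module) J
  rw [h0, hc] at h1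
  linarith

end Support

/-! ### Stokes theorem for differential 1-chains. -/

section Stokes

variable {E : Type*} [NormedAddCommGroup E] [InnerProductSpace ℝ E] {r : ℕ}

/-- Continuity moves the integral inside the limit defining `P_v`; what is left are difference
quotients of the coefficient of `G`, which tend to a directional derivative. -/
theorem integral_prederivative_single (hr : 1 ≤ r) (v p : E) (a : ℝ) (G : BForm E ℝ (r + 1))
    {L : E →L[ℝ] ℝ} (hG : HasFDerivAt (fun q => G.toFun q 1) L p) :
    integral (prederivative hr v
      ((PointedChain.toFinsupp.symm (Finsupp.single p a) : PointedChain E ℝ r) : Chain E ℝ r)) G =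
      a * L v := by
  rw [prederivative, Chain.extend_coe]
  have h1 := ((continuous_integral G).tendsto _).comp (tendsto_prederivativePointed hr v
    (PointedChain.toFinsupp.symm (Finsupp.single p a)))
  refine tendsto_nhds_unique h1 ?_
  have h2 := (hG.hasLineDerivAt v).tendsto_slope_zero.const_mul a
  refine h2.congr fun t => ?_
  have h3 : ∀ q, G.toFun q a = a * G.toFun q 1 := fun q => by
    rw [← smul_eq_mul, ← map_smul, smul_eq_mul, mul_one]
  have h4 : integral (diffQuotient v t
      (PointedChain.toFinsupp.symm (Finsupp.single p a) : PointedChain E ℝ r) :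
        Chain E ℝ (r + 1)) G =
      Finsupp.lsum ℝ G.toFun (difference (t • v) (t⁻¹ • Finsupp.single p a)) :=
    integral_coe _ _
  simp only [Function.comp]
  rw [h4, map_smul, map_smul, lsum_difference, Finsupp.lsum_single, LinearMap.sub_apply, h3, h3]
  simp only [smul_eq_mul]
  ring

theorem retraction_single (v p w : E) :
    retraction v ((PointedChain.toFinsupp.symm (Finsupp.single p w) : PointedChain E E r) :
      Chain E E r) =
    ((PointedChain.toFinsupp.symm (Finsupp.single p (inner ℝ v w)) : PointedChain E ℝ r) :
      Chain E ℝ r) := by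
  refine (Chain.extend_coe _ _).trans ?_
  have h : retractionFinsupp v (Finsupp.single p w) = Finsupp.single p (inner ℝ v w) := by
    simp [retractionFinsupp]
  rw [← h]
  rfl

theorem boundary_single [FiniteDimensional ℝ E] (hr : 1 ≤ r) (p w : E) :
    boundary hr ((PointedChain.toFinsupp.symm (Finsupp.single p w) : PointedChain E E r) :
      Chain E E r) =
    ∑ i, prederivative hr (stdOrthonormalBasis ℝ E i)
      ((PointedChain.toFinsupp.symm (Finsupp.single p (inner ℝ (stdOrthonormalBasis ℝ E i) w)) :
        PointedChain E ℝ r) : Chain E ℝ r) := by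
  rw [boundary, _root_.sum_apply]
  refine Finset.sum_congr rfl fun i _ => ?_
  rw [ContinuousLinearMap.comp_apply, retraction_single]

/-- **Stokes theorem** for differential `1`-chains: `∫_{∂J} G = ∫_J dG`. -/
theorem integral_boundary [FiniteDimensional ℝ E] (hr : 1 ≤ r) (J : Chain E E r)
    (G : BForm E ℝ (r + 1)) (dG : BForm E E r) {L : E → E →L[ℝ] ℝ}
    (hG : ∀ p, HasFDerivAt (fun q => G.toFun q 1) (L p) p) (hdG : ∀ p w, dG.toFun p w = L p w) :
    integral (boundary hr J) G = integral J dG := by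
  induction J using UniformSpace.Completion.induction_on with
  | hp =>
    exact isClosed_eq ((continuous_integral G).comp (boundary hr).continuous)
      (continuous_integral dG)
  | ih A =>
    -- By density and linearity only a single `(p; w)` matters.
    suffices H : ∀ B : E →₀ E,
        integral (boundary hr
          ((PointedChain.toFinsupp.symm B : PointedChain E E r) : Chain E E r)) G =
        integral ((PointedChain.toFinsupp.symm B : PointedChain E E r) : Chain E E r) dG from
      H A.toFinsupp
    intro B
    induction B using Finsupp.induction_linear with
    | zero =>
      rw [map_zero, UniformSpace.Completion.coe_zero, map_zero]
      exact (map_zero (Chain.extend G.eval)).trans (map_zero (Chain.extend dG.eval)).symm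
    | add B B' hB hB' =>
      rw [map_add, UniformSpace.Completion.coe_add, map_add, integral_add_chain, hB, hB',
        integral_add_chain]
    | single p w =>
      rw [boundary_single, integral_coe]
      have h1 : dG.eval (PointedChain.toFinsupp.symm (Finsupp.single p w)) = L p w := by
        rw [← hdG]
        exact Finsupp.lsum_single ℝ dG.toFun p w
      rw [h1]
      have h2 := map_sum (Chain.extend G.eval) (fun i => prederivative hr (stdOrthonormalBasis ℝ E i)
        ((PointedChain.toFinsupp.symm (Finsupp.single p (inner ℝ (stdOrthonormalBasis ℝ E i) w)) :
          PointedChain E ℝ r) : Chain E ℝ r)) Finset.univ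
      refine h2.trans ((Finset.sum_congr rfl fun i _ =>
        integral_prederivative_single hr _ p _ G (hG p)).trans ?_)
      -- The directional derivatives weighted by `⟪vᵢ, w⟫` recombine to `L p w` by expanding `w` in
      -- the orthonormal basis.
      conv_rhs => rw [← (stdOrthonormalBasis ℝ E).sum_repr' w, map_sum]
      simp

end Stokes

/-! ### Primitives on simply connected open sets. -/

/-- On a simply connected space every locally constant cocycle is a coboundary. -/
theorem exists_eventually_eq_of_cocycle {X ι G : Type*} [TopologicalSpace X]
    [SimplyConnectedSpace X] [LocallyPathConnectedSpace X] [AddCommGroup G] (U : ι → Set X)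
    (hU : ∀ i, IsOpen (U i)) (idx : X → ι) (hidx : ∀ x, x ∈ U (idx x)) (c : ι → ι → X → G)
    (hloc : ∀ i j, ∀ x ∈ U i ∩ U j, ∀ᶠ y in 𝓝 x, c i j y = c i j x)
    (hc : ∀ i j k, ∀ x ∈ U i ∩ U j ∩ U k, c i j x + c j k x = c i k x) :
    ∃ s : X → G, ∀ i, ∀ x ∈ U i, ∀ᶠ y in 𝓝 x,
      s y + c (idx y) i y = s x + c (idx x) i x := by
  -- With `G` discrete, the bundle glued by the translations `v ↦ v + c i j x` is a covering of `X`.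
  let _ : TopologicalSpace G := ⊥
  have : DiscreteTopology G := ⟨rfl⟩
  let Z : FiberBundleCore ι X G :=
    { baseSet := U
      isOpen_baseSet := hU
      indexAt := idx
      mem_baseSet_at := hidx
      coordChange := fun i j x v => v + c i j x
      coordChange_self := fun i x hx v => by
        have := hc i i i x ⟨⟨hx, hx⟩, hx⟩
        rw [add_eq_left] at this
        rw [this, add_zero]
      continuousOn_coordChange := fun i j => by
        rintro ⟨x, v⟩ ⟨hx, -⟩
        refine ContinuousAt.continuousWithinAt (continuousAt_snd.add ?_)
        have h : ContinuousAt (c i j) x :=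
          (continuousAt_const (y := c i j x)).congr ((hloc i j x hx).mono fun y hy => hy.symm)
        exact h.comp continuousAt_fst
      coordChange_comp := fun i j k x hx v => by rw [add_assoc, hc i j k x hx] }
  have cov : IsCoveringMap (Bundle.TotalSpace.proj : Bundle.TotalSpace G Z.Fiber → X) :=
    FiberBundle.isCoveringMap
  obtain ⟨x₀⟩ : Nonempty X := inferInstance
  -- Lifting the identity of the simply connected `X` gives a global section. In each chart it is a
  -- continuous map to a discrete group, hence locally constant.
  obtain ⟨F, ⟨-, hF⟩, -⟩ := cov.existsUnique_continuousMap_lifts (ContinuousMap.id X) x₀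
    ⟨x₀, (0 : G)⟩ rfl
  have hF' : ∀ x, (F x).1 = x := fun x => congrFun hF x
  let s : X → G := fun x => (F x).2
  refine ⟨s, fun i x hx => ?_⟩
  have hsrc : F x ∈ (Z.localTriv i).source := by
    rw [(Z.localTriv i).mem_source]
    change (F x).1 ∈ U i
    rwa [hF']
  have h1 : ContinuousAt (fun y => (Z.localTriv i (F y)).2) x :=
    continuousAt_snd.comp (((Z.localTriv i).continuousAt hsrc).comp F.continuous.continuousAt)
  have h2 : ∀ y, (Z.localTriv i (F y)).2 = s y + c (idx y) i y := fun y => by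
    change s y + c (idx (F y).1) i (F y).1 = _
    rw [hF']
  simp only [h2] at h1
  have h3 := h1.eventually ((isOpen_discrete {s x + c (idx x) i x}).mem_nhds rfl)
  exact h3

/-- Holomorphic functions on simply connected open sets have primitives. -/
theorem isExactOn_of_simplyConnectedSpace {U : Set ℂ} (hU : IsOpen U) [SimplyConnectedSpace U]
    {f : ℂ → ℂ} (hf : DifferentiableOn ℂ f U) : Complex.IsExactOn f U := by
  have hball : ∀ z : U, ∃ ε > 0, Metric.ball (z : ℂ) ε ⊆ U := fun z =>
    Metric.isOpen_iff.1 hU z z.2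
  choose ε hε hεU using hball
  have hprim : ∀ z : U, ∃ P : ℂ → ℂ, ∀ w ∈ Metric.ball (z : ℂ) (ε z), HasDerivAt P (f w) w :=
    fun z => (hf.mono (hεU z)).isExactOn_ball
  choose P hP using hprim
  have : LocallyPathConnectedSpace U := hU.locallyPathConnectedSpace
  let B : U → Set U := fun z => Subtype.val ⁻¹' Metric.ball (z : ℂ) (ε z)
  have hB : ∀ z, z ∈ B z := fun z => Metric.mem_ball_self (hε z)
  obtain ⟨s, hs⟩ := exists_eventually_eq_of_cocycle B
    (fun z => Metric.isOpen_ball.preimage continuous_subtype_val) id hB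
    (fun i j y => P i y - P j y) (by
      rintro i j x ⟨hi, hj⟩
      have hopen : IsOpen (Metric.ball (i : ℂ) (ε i) ∩ Metric.ball (j : ℂ) (ε j)) :=
        Metric.isOpen_ball.inter Metric.isOpen_ball
      have hder : ∀ w ∈ Metric.ball (i : ℂ) (ε i) ∩ Metric.ball (j : ℂ) (ε j),
          HasDerivAt (fun w => P i w - P j w) 0 w := fun w hw => by
        have h := (hP i w hw.1).sub (hP j w hw.2)
        rw [sub_self] at h
        exact h
      -- Two local primitives differ by a constant on the intersection of two balls, which is convex
      -- and so connected.
      have hconst : ∀ᶠ w in 𝓝 (x : ℂ), P i w - P j w = P i x - P j x := by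
        filter_upwards [hopen.mem_nhds ⟨hi, hj⟩] with w hw
        exact hopen.is_const_of_deriv_eq_zero
          ((convex_ball _ _).inter (convex_ball _ _)).isPreconnected
          (fun v hv => (hder v hv).differentiableAt.differentiableWithinAt)
          (fun v hv => (hder v hv).deriv) hw ⟨hi, hj⟩
      exact continuous_subtype_val.continuousAt.eventually hconst) (by intros; abel)
  classical
  -- Each point uses the primitive of its own ball, corrected by `s`. Near `z` the relation from
  -- `hs` identifies this function with `P z` plus the constant `s z`.
  refine ⟨fun z => if h : z ∈ U then P ⟨z, h⟩ z + s ⟨z, h⟩ else 0, fun z hz => ?_⟩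
  have h1 := hs ⟨z, hz⟩ ⟨z, hz⟩ (hB _)
  refine ((hP ⟨z, hz⟩ z (hB ⟨z, hz⟩)).add_const (s ⟨z, hz⟩)).congr_of_eventuallyEq ?_
  rw [nhds_subtype_eq_comap, eventually_comap] at h1
  filter_upwards [h1, hU.mem_nhds hz] with w hw hwU
  have h2 := hw ⟨w, hwU⟩ rfl
  simp only [id, sub_self, add_zero] at h2
  simp only [hwU, dif_pos, ← h2]
  ring

/-! ### Exact forms over closed chains, and the theorem. -/

/-- A smooth function defined near a compact set can be extended from a neighbourhood of it to a
smooth function with compact support. -/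
theorem exists_contDiff_hasCompactSupport_eventuallyEq {E W : Type*} [NormedAddCommGroup E]
    [NormedSpace ℝ E] [FiniteDimensional ℝ E] [NormedAddCommGroup W] [NormedSpace ℝ W]
    {K U : Set E} (hK : IsCompact K) (hU : IsOpen U) (hKU : K ⊆ U) {F : E → W}
    (hF : ∀ z ∈ U, ContDiffAt ℝ (⊤ : ℕ∞) F z) :
    ∃ g : E → W, ContDiff ℝ (⊤ : ℕ∞) g ∧ HasCompactSupport g ∧ ∀ᶠ z in 𝓝ˢ K, g z = F z := by
  obtain ⟨L, hL, hKL, hLU⟩ := exists_compact_between hK hU hKU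
  obtain ⟨χ, hχ1, hχ0, -⟩ := exists_contMDiffMap_one_nhds_of_subset_interior
    (n := (⊤ : ℕ∞)) (modelWithCornersSelf ℝ E) hK.isClosed hKL
  have hχ : ContDiff ℝ (⊤ : ℕ∞) χ := χ.contMDiff.contDiff
  refine ⟨fun z => χ z • F z, contDiff_iff_contDiffAt.2 fun z => ?_,
    HasCompactSupport.intro hL fun z hz => by rw [hχ0 z hz, zero_smul], ?_⟩
  -- Off `U` nothing is known about `F`, but there the cutoff vanishes on a whole neighbourhood, the
  -- complement of `L`.
  · by_cases hz : z ∈ U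
    · exact hχ.contDiffAt.smul (hF z hz)
    · have h0 : (fun w => χ w • F w) =ᶠ[𝓝 z] fun _ => 0 := by
        filter_upwards [hL.isClosed.isOpen_compl.mem_nhds fun h => hz (hLU h)] with w hw
        rw [hχ0 w hw, zero_smul]
      exact contDiffAt_const.congr_of_eventuallyEq h0
  · filter_upwards [hχ1] with z hz
    rw [hz, one_smul]

theorem isClosed_supp {E V : Type*} [NormedAddCommGroup E] [NormedAddCommGroup V]
    [NormedSpace ℝ V] {r : ℕ} (J : Chain E V r) : IsClosed J.supp :=
  isClosed_sInter fun _ hX => hX.1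

/-- The integral of an exact form over a closed chain vanishes. -/
theorem hasIntegral_zero_of_boundary_eq_zero {E : Type} [NormedAddCommGroup E]
    [InnerProductSpace ℝ E] [FiniteDimensional ℝ E] [Nontrivial E] {r : ℕ} (hr : 1 ≤ r)
    {J : Chain E E r} (hJ : boundary hr J = 0) (hK : IsCompact J.supp) {U : Set E}
    (hU : IsOpen U) (hJU : J.supp ⊆ U) {F : E → ℝ}
    (hF : ∀ z ∈ U, ContDiffAt ℝ (⊤ : ℕ∞) F z) {η : E → E →ₗ[ℝ] ℝ}
    (hη : ∀ z ∈ U, η z = fderiv ℝ F z) : HasIntegral J η 0 := by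
  obtain ⟨g, hg, hgs, hgF⟩ := exists_contDiff_hasCompactSupport_eventuallyEq hK hU hJU hF
  -- Order `r + 1` for `g`, which is paired with `∂J`; order `r` suffices for its derivative, paired
  -- with `J`.
  obtain ⟨C, hC⟩ := exists_diffBounded_of_hasCompactSupport (r + 1) hg hgs
  obtain ⟨D, hD⟩ := exists_diffBounded_of_hasCompactSupport r
    (hg.fderiv_right (m := (⊤ : ℕ∞)) (by simp)) (hgs.fderiv (𝕜 := ℝ))
  let G : BForm E ℝ (r + 1) := BForm.ofDiffBounded (fun p => g p • LinearMap.id) ⟨C, fun a => by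
    intro V p hV
    refine (congrArg norm (diffFun_map_apply (AddMonoidHom.mulRight a) V g p)).trans_le ?_
    rw [AddMonoidHom.mulRight_apply, norm_mul, mul_right_comm]
    exact mul_le_mul_of_nonneg_right (hC V p hV) (norm_nonneg _)⟩
  let dG : BForm E E r := BForm.ofDiffBounded (fun p => (fderiv ℝ g p : E →ₗ[ℝ] ℝ)) ⟨D, fun a => by
    intro V p hV
    refine (congrArg norm (diffFun_map_apply (ContinuousLinearMap.apply ℝ ℝ a) V
      (fderiv ℝ g) p)).trans_le ?_
    rw [mul_right_comm]
    exact (ContinuousLinearMap.le_opNorm _ a).trans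
      (mul_le_mul_of_nonneg_right (hD V p hV) (norm_nonneg _))⟩
  refine HasIntegral.of_form dG ?_ ?_
  · obtain ⟨N, hN, hJN, hgN⟩ := eventually_nhdsSet_iff_exists.1 hgF
    filter_upwards [hN.mem_nhdsSet.2 hJN, hU.mem_nhdsSet.2 hJU] with p hp hpU
    rw [hη p hpU, ← Filter.EventuallyEq.fderiv_eq (f₁ := g)
      (eventually_of_mem (hN.mem_nhds hp) fun q hq => hgN q hq)]
    rfl
  · have hder : ∀ p, HasFDerivAt (fun q => G.toFun q 1) (fderiv ℝ g p) p := fun p => by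
      have h : (fun q => G.toFun q 1) = g := funext fun q => mul_one (g q)
      rw [h]
      exact (hg.differentiable (by simp) p).hasFDerivAt
    rw [← integral_boundary hr J G dG hder fun p w => rfl, hJ]
    exact map_zero (Chain.extend G.eval)

end Harrison

end

theorem mainTheorem1 (U : Set ℂ) (hU_bounded : Bornology.IsBounded U) (hU_open : IsOpen U)
    (hU_contractible : ContractibleSpace U) (f : ℂ → ℂ) (hf : DifferentiableOn ℂ f U)
    (r : ℕ) (hr : 1 ≤ r) (J : Harrison.Chain ℂ ℂ r) (hJ_closed : Harrison.boundary hr J = 0)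
    (hJ_supp : J.supp ⊆ U) :
    Harrison.HasComplexIntegral J f 0 := by
  obtain ⟨F, hF⟩ := Harrison.isExactOn_of_simplyConnectedSpace hU_open hf
  have hK : IsCompact J.supp :=
    Metric.isCompact_of_isClosed_isBounded (Harrison.isClosed_supp J) (hU_bounded.subset hJ_supp)
  have hsmooth : ∀ z ∈ U, ContDiffAt ℝ (⊤ : ℕ∞) F z := fun z hz => by
    have h : DifferentiableOn ℂ F U := fun w hw =>
      (hF w hw).differentiableAt.differentiableWithinAt
    exact (h.analyticAt (hU_open.mem_nhds hz)).contDiffAt.restrict_scalars ℝ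
  -- The real differential of `L ∘ F` is `h ↦ L (h f(z))`. For `L = Re` this is `u dx - v dy`, for
  -- `L = Im` it is `v dx + u dy`.
  have hder : ∀ z ∈ U, ∀ L : ℂ →L[ℝ] ℝ,
      fderiv ℝ (fun w => L (F w)) z =
        L.comp ((ContinuousLinearMap.toSpanSingleton ℂ (f z)).restrictScalars ℝ) :=
    fun z hz L => (L.hasFDerivAt.comp z ((hF z hz).hasFDerivAt.restrictScalars ℝ)).fderiv
  constructor
  · refine Harrison.hasIntegral_zero_of_boundary_eq_zero hr hJ_closed hK hU_open hJ_supp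
      (F := fun w => Complex.reCLM (F w))
      (fun z hz => Complex.reCLM.contDiff.contDiffAt.comp z (hsmooth z hz)) fun z hz => ?_
    rw [hder z hz]
    ext w
    simp
    ring
  · refine Harrison.hasIntegral_zero_of_boundary_eq_zero hr hJ_closed hK hU_open hJ_supp
      (F := fun w => Complex.imCLM (F w))
      (fun z hz => Complex.imCLM.contDiff.contDiffAt.comp z (hsmooth z hz)) fun z hz => ?_
    rw [hder z hz]
    ext w
    simp
    ring
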